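/- Let $(X,\rho)$ be a metric space. For $f\colon X\to\mathbb R$ put $L(f)=\sup_{p\ne q}|f(p)-f(q)|/\rho(p,q)$, and let $\mathrm{Lip}(X)$ be the real vector space of bounded Lipschitz functions $f\colon X\to\mathbb R$ with the norm $\|f\|_L=\max(L(f),\|f\|_\infty)$. Let $Y=X\cup\{e\}$ be the pointed metric space with base point $e$ and metric $\rho^Y(p,q)=\min(\rho(p,q),2)$ and $\rho^Y(p,e)=1$ for $p,q\in X$. Let $\mathrm{Lip}_0(Y)$ be the space of Lipschitz functions $Y\to\mathbb R$ that vanish at $e$, with norm $L(\cdot)$, and let the Arens–Eells space $\text{Æ}(Y)$ be the closed linear span in $\mathrm{Lip}_0(Y)^*$ of the point evaluations $\delta_p\colon f\mapsto f(p)$, $p\in Y$. Then $\text{Æ}(Y)$ is the strongly unique Banach space predual of $\mathrm{Lip}(X)$. That is: 1. there is a (necessarily unique) surjective linear isometry $J\colon\mathrm{Lip}(X)\to\text{Æ}(Y)^*$ with $(Jf)(\delta_p)=f(p)$ for all $f\in\mathrm{Lip}(X)$ and $p\in X$; and 2. for every real Banach space $W$, every surjective linear isometry $\varphi\colon\mathrm{Lip}(X)\to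 W^*$ is continuous from the weak* topology that $\mathrm{Lip}(X)$ receives from $\text{Æ}(Y)$ through $J$ to the weak* topology of $W^*$. -/

import Mathlib

open scoped NNReal

universe u v w

noncomputable section

/-- The Lipschitz number `L(f) = sup_{p ≠ q} |f p - f q| / ρ(p, q)` of a Lipschitz function `f`
(it is `0` if the space has at most one point). It is only used for functions that satisfy a
Lipschitz condition, for which the supremum is over a bounded set. -/
def lipNumber {X : Type*} [MetricSpace X] (f : X → ℝ) : ℝ :=
  ⨆ z : {z : X × X // z.1 ≠ z.2}, |f z.1.1 - f z.1.2| / dist z.1.1 z.1.2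

/-- The sup norm of a bounded function. -/
def supNumber {X : Type*} (f : X → ℝ) : ℝ := ⨆ p : X, |f p|

section aux

variable {X : Type*} [MetricSpace X] {f g : X → ℝ}

theorem bddAbove_slopes (hf : ∃ K : ℝ≥0, LipschitzWith K f) :
    BddAbove (Set.range fun z : {z : X × X // z.1 ≠ z.2} =>
      |f z.1.1 - f z.1.2| / dist z.1.1 z.1.2) := by
  obtain ⟨K, hK⟩ := hf
  refine ⟨K, ?_⟩
  rintro _ ⟨z, rfl⟩
  have h := hK.dist_le_mul z.1.1 z.1.2
  rw [Real.dist_eq] at h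
  exact (div_le_iff₀ (dist_pos.2 z.2)).2 h

theorem lipNumber_nonneg (f : X → ℝ) : 0 ≤ lipNumber f :=
  Real.iSup_nonneg fun _ => by positivity

theorem abs_sub_le_lipNumber (hf : ∃ K : ℝ≥0, LipschitzWith K f) (p q : X) :
    |f p - f q| ≤ lipNumber f * dist p q := by
  by_cases h : p = q
  · simp [h]
  · have := le_ciSup (bddAbove_slopes hf) ⟨(p, q), h⟩
    exact (div_le_iff₀ (dist_pos.2 h)).1 this

theorem lipNumber_le {c : ℝ} (hc : 0 ≤ c) (h : ∀ p q, |f p - f q| ≤ c * dist p q) :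
    lipNumber f ≤ c :=
  Real.iSup_le (fun z => (div_le_iff₀ (dist_pos.2 z.2)).2 (h _ _)) hc

theorem lipNumber_add_le (hf : ∃ K : ℝ≥0, LipschitzWith K f)
    (hg : ∃ K : ℝ≥0, LipschitzWith K g) :
    lipNumber (f + g) ≤ lipNumber f + lipNumber g := by
  refine lipNumber_le (add_nonneg (lipNumber_nonneg _) (lipNumber_nonneg _)) fun p q => ?_
  have h1 := abs_sub_le_lipNumber hf p q
  have h2 := abs_sub_le_lipNumber hg p q
  have h3 : (f + g) p - (f + g) q = (f p - f q) + (g p - g q) := by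
    simp only [Pi.add_apply]; ring
  rw [h3, add_mul]
  exact (abs_add_le _ _).trans (add_le_add h1 h2)

theorem lipNumber_smul (c : ℝ) (f : X → ℝ) : lipNumber (c • f) = |c| * lipNumber f := by
  unfold lipNumber
  rw [Real.mul_iSup_of_nonneg (abs_nonneg c)]
  refine congrArg iSup (funext fun z => ?_)
  simp only [Pi.smul_apply, smul_eq_mul, ← mul_sub, abs_mul, mul_div_assoc]

theorem supNumber_nonneg {X : Type*} (f : X → ℝ) : 0 ≤ supNumber f :=
  Real.iSup_nonneg fun _ => abs_nonneg _

theorem abs_le_supNumber {X : Type*} {f : X → ℝ} (hf : ∃ C : ℝ, ∀ p, |f p| ≤ C) (p : X) :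
    |f p| ≤ supNumber f := by
  obtain ⟨C, hC⟩ := hf
  exact le_ciSup (f := fun p => |f p|) ⟨C, by rintro _ ⟨q, rfl⟩; exact hC q⟩ p

theorem supNumber_add_le {X : Type*} {f g : X → ℝ} (hf : ∃ C : ℝ, ∀ p, |f p| ≤ C)
    (hg : ∃ C : ℝ, ∀ p, |g p| ≤ C) : supNumber (f + g) ≤ supNumber f + supNumber g :=
  Real.iSup_le (fun p => (abs_add_le _ _).trans
    (add_le_add (abs_le_supNumber hf p) (abs_le_supNumber hg p)))
    (add_nonneg (supNumber_nonneg _) (supNumber_nonneg _))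

theorem supNumber_smul {X : Type*} (c : ℝ) (f : X → ℝ) :
    supNumber (c • f) = |c| * supNumber f := by
  unfold supNumber
  rw [Real.mul_iSup_of_nonneg (abs_nonneg c)]
  refine congrArg iSup (funext fun z => ?_)
  simp [abs_mul]

theorem exists_lipschitzWith_add (hf : ∃ K : ℝ≥0, LipschitzWith K f)
    (hg : ∃ K : ℝ≥0, LipschitzWith K g) : ∃ K : ℝ≥0, LipschitzWith K (f + g) :=
  ⟨_, hf.choose_spec.add hg.choose_spec⟩

theorem exists_lipschitzWith_smul (c : ℝ) (hf : ∃ K : ℝ≥0, LipschitzWith K f) :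
    ∃ K : ℝ≥0, LipschitzWith K (c • f) :=
  ⟨_, (lipschitzWith_smul c).comp hf.choose_spec⟩

end aux

/-! ### The space `Lip(X)` -/

/-- The vector space of bounded Lipschitz functions `X → ℝ`. -/
def lipSubmodule (X : Type*) [MetricSpace X] : Submodule ℝ (X → ℝ) where
  carrier := {f | (∃ K : ℝ≥0, LipschitzWith K f) ∧ ∃ C : ℝ, ∀ p, |f p| ≤ C}
  zero_mem' := ⟨⟨0, LipschitzWith.const 0⟩, 0, by simp⟩
  add_mem' := by
    rintro f g ⟨hf, C, hC⟩ ⟨hg, D, hD⟩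
    exact ⟨exists_lipschitzWith_add hf hg, C + D,
      fun p => (abs_add_le _ _).trans (add_le_add (hC p) (hD p))⟩
  smul_mem' := by
    rintro c f ⟨hf, C, hC⟩
    refine ⟨exists_lipschitzWith_smul c hf, |c| * C, fun p => ?_⟩
    simp only [Pi.smul_apply, smul_eq_mul, abs_mul]
    exact mul_le_mul_of_nonneg_left (hC p) (abs_nonneg c)

/-- `Lip(X)`: the bounded Lipschitz functions `X → ℝ`, normed below by
`‖f‖ = max (L(f)) (‖f‖_∞)`. (A type synonym, to keep the product topology of `X → ℝ` away.) -/
def Lip (X : Type*) [MetricSpace X] : Type _ := lipSubmodule X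

namespace Lip

variable {X : Type*} [MetricSpace X]

abbrev addCommGroup : AddCommGroup (Lip X) := inferInstanceAs (AddCommGroup (lipSubmodule X))

attribute [local instance] addCommGroup

abbrev module : Module ℝ (Lip X) := inferInstanceAs (Module ℝ (lipSubmodule X))

attribute [local instance] module

instance : CoeFun (Lip X) fun _ => X → ℝ := ⟨fun f => f.1⟩

instance : Norm (Lip X) := ⟨fun f => max (lipNumber f) (supNumber f)⟩

theorem normCore : NormedSpace.Core ℝ (Lip X) where
  norm_nonneg f := le_max_of_le_left (lipNumber_nonneg _)
  norm_smul c f := by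
    change max (lipNumber (c • f.1)) (supNumber (c • f.1)) = |c| * max _ _
    rw [lipNumber_smul, supNumber_smul, mul_max_of_nonneg _ _ (abs_nonneg c)]
  norm_triangle f g := by
    change max (lipNumber (f.1 + g.1)) (supNumber (f.1 + g.1)) ≤ max _ _ + max _ _
    exact max_le
      ((lipNumber_add_le f.2.1 g.2.1).trans (add_le_add (le_max_left _ _) (le_max_left _ _)))
      ((supNumber_add_le f.2.2 g.2.2).trans (add_le_add (le_max_right _ _) (le_max_right _ _)))
  norm_eq_zero_iff f := by
    constructor
    · intro h
      refine Subtype.ext (funext fun p => ?_)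
      have h1 : |f.1 p| ≤ 0 := h ▸ (abs_le_supNumber f.2.2 p).trans (le_max_right _ _)
      exact abs_nonpos_iff.1 h1
    · rintro rfl
      change max (lipNumber (0 : X → ℝ)) (supNumber (0 : X → ℝ)) = 0
      simp [lipNumber, supNumber]

instance : NormedAddCommGroup (Lip X) := NormedAddCommGroup.ofCore normCore

instance : NormedSpace ℝ (Lip X) := NormedSpace.ofCore normCore

end Lip

/-! ### The space `Lip₀(Y)` of a pointed metric space -/

/-- The vector space of Lipschitz functions `Y → ℝ` that vanish at the base point `e`. -/
def lipZeroSubmodule (Y : Type*) [MetricSpace Y] (e : Y) : Submodule ℝ (Y → ℝ) where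
  carrier := {f | (∃ K : ℝ≥0, LipschitzWith K f) ∧ f e = 0}
  zero_mem' := ⟨⟨0, LipschitzWith.const 0⟩, rfl⟩
  add_mem' := by
    rintro f g ⟨hf, hf0⟩ ⟨hg, hg0⟩
    exact ⟨exists_lipschitzWith_add hf hg, by simp [hf0, hg0]⟩
  smul_mem' := by
    rintro c f ⟨hf, hf0⟩
    exact ⟨exists_lipschitzWith_smul c hf, by simp [hf0]⟩

/-- `Lip₀(Y)`: the (possibly unbounded) Lipschitz functions `Y → ℝ` that vanish at the base
point `e`, normed below by the Lipschitz number. -/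
def LipZero (Y : Type*) [MetricSpace Y] (e : Y) : Type _ := lipZeroSubmodule Y e

namespace LipZero

variable {Y : Type*} [MetricSpace Y] {e : Y}

abbrev addCommGroup : AddCommGroup (LipZero Y e) := inferInstanceAs (AddCommGroup (lipZeroSubmodule Y e))

attribute [local instance] addCommGroup

abbrev module : Module ℝ (LipZero Y e) := inferInstanceAs (Module ℝ (lipZeroSubmodule Y e))

attribute [local instance] module

instance : CoeFun (LipZero Y e) fun _ => Y → ℝ := ⟨fun f => f.1⟩

instance : Norm (LipZero Y e) := ⟨fun f => lipNumber f⟩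

theorem abs_apply_le (f : LipZero Y e) (p : Y) : |f p| ≤ dist p e * ‖f‖ := by
  have h := abs_sub_le_lipNumber f.2.1 p e
  rw [f.2.2, sub_zero, mul_comm] at h
  exact h

theorem normCore : NormedSpace.Core ℝ (LipZero Y e) where
  norm_nonneg f := lipNumber_nonneg _
  norm_smul c f := lipNumber_smul c f.1
  norm_triangle f g := lipNumber_add_le f.2.1 g.2.1
  norm_eq_zero_iff f := by
    constructor
    · intro h
      refine Subtype.ext (funext fun p => ?_)
      have h1 := abs_apply_le f p
      rw [h, mul_zero] at h1
      exact abs_nonpos_iff.1 h1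
    · rintro rfl
      change lipNumber (0 : Y → ℝ) = 0
      simp [lipNumber]

instance : NormedAddCommGroup (LipZero Y e) := NormedAddCommGroup.ofCore normCore

instance : NormedSpace ℝ (LipZero Y e) := NormedSpace.ofCore normCore

end LipZero

/-- The point evaluation `δ_p : f ↦ f p`, an element of the dual of `Lip₀(Y)`. -/
def LipZero.eval {Y : Type*} [MetricSpace Y] (e p : Y) : StrongDual ℝ (LipZero Y e) :=
  LinearMap.mkContinuous
    { toFun := fun f => f p
      map_add' := fun _ _ => rfl
      map_smul' := fun _ _ => rfl }
    (dist p e) fun f => LipZero.abs_apply_le f p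

/-- The closed linear span in `Lip₀(Y)*` of the point evaluations. -/
def arensEellsSubmodule (Y : Type*) [MetricSpace Y] (e : Y) :
    Submodule ℝ (StrongDual ℝ (LipZero Y e)) :=
  (Submodule.span ℝ (Set.range (LipZero.eval e))).topologicalClosure

/-- The Arens-Eells space `Æ(Y)` of a pointed metric space `(Y, e)` (also known as the
Lipschitz-free space): the closed linear span in `Lip₀(Y)*` of the point evaluations, with the
norm of `Lip₀(Y)*`. -/
def ArensEells (Y : Type*) [MetricSpace Y] (e : Y) : Type _ := arensEellsSubmodule Y e

namespace ArensEells

variable {Y : Type*} [MetricSpace Y] {e : Y}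

instance : NormedAddCommGroup (ArensEells Y e) :=
  inferInstanceAs (NormedAddCommGroup (arensEellsSubmodule Y e))

instance : NormedSpace ℝ (ArensEells Y e) :=
  inferInstanceAs (NormedSpace ℝ (arensEellsSubmodule Y e))

instance : CompleteSpace (ArensEells Y e) :=
  inferInstanceAs
    (CompleteSpace (Submodule.span ℝ (Set.range (LipZero.eval e))).topologicalClosure)

/-- The point evaluation `δ_p` as an element of `Æ(Y)`. -/
def delta (e p : Y) : ArensEells Y e :=
  ⟨LipZero.eval e p, Submodule.le_topologicalClosure _ (Submodule.subset_span ⟨p, rfl⟩)⟩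

end ArensEells

/-! ### The pointed space `X ∪ {e}` -/

/-- The set `X ∪ {e}`; the new point `e` is `none`. -/
def WithBase (X : Type*) : Type _ := Option X

namespace WithBase

variable {X : Type*}

/-- The base point `e`. -/
def base : WithBase X := (none : Option X)

/-- The inclusion `X ⊆ X ∪ {e}`. -/
def of (p : X) : WithBase X := (some p : Option X)

/-- The metric on `X ∪ {e}`: `min (ρ(p, q)) 2` on `X`, and `ρ(p, e) = 1` for all `p ∈ X`. -/
def distFun [MetricSpace X] : Option X → Option X → ℝ
  | none, none => 0
  | none, some _ => 1
  | some _, none => 1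
  | some p, some q => min (dist p q) 2

instance [MetricSpace X] : MetricSpace (WithBase X) where
  dist := distFun
  dist_self := by
    rintro (_ | p) <;> simp [distFun]
  dist_comm := by
    rintro (_ | p) (_ | q) <;> simp [distFun, dist_comm]
  dist_triangle := by
    rintro (_ | p) (_ | q) (_ | r) <;> simp only [distFun]
    · norm_num
    · norm_num
    · norm_num
    · linarith [le_min (dist_nonneg (x := q) (y := r)) (zero_le_two (α := ℝ))]
    · norm_num
    · exact (min_le_right _ _).trans (by norm_num)
    · linarith [le_min (dist_nonneg (x := p) (y := q)) (zero_le_two (α := ℝ))]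
    · have h := dist_triangle p q r
      have h1 := dist_nonneg (x := p) (y := q)
      have h2 := dist_nonneg (x := q) (y := r)
      rcases le_total (dist p q) 2 with a | a <;> rcases le_total (dist q r) 2 with b | b
      · rw [min_eq_left a, min_eq_left b]; exact (min_le_left _ _).trans h
      · rw [min_eq_right b]; exact (min_le_right _ _).trans (by linarith [le_min h1 zero_le_two])
      · rw [min_eq_right a]; exact (min_le_right _ _).trans (by linarith [le_min h2 zero_le_two])
      · rw [min_eq_right a]; exact (min_le_right _ _).trans (by linarith [le_min h2 zero_le_two])
  eq_of_dist_eq_zero := by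
    rintro (_ | p) (_ | q) h
    · rfl
    · exact absurd h one_ne_zero
    · exact absurd h one_ne_zero
    · have h' : min (dist p q) 2 = 0 := h
      rcases min_choice (dist p q) 2 with a | a
      · rw [a] at h'; rw [dist_eq_zero.1 h']
      · rw [a] at h'; norm_num at h'

end WithBase

/-! ### Strongly unique preduals -/

/-- Let `E` be a dual Banach space, identified with `V*` by the isometric isomorphism `J`. Then
`V` is a strongly unique predual of `E` if every isometric isomorphism `φ` of `E` onto the dual
`W*` of a Banach space `W` is continuous for the weak* topologies that come from `V` and `W`. -/
def IsStronglyUniquePredual {E : Type u} [NormedAddCommGroup E] [NormedSpace ℝ E]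
    {V : Type v} [NormedAddCommGroup V] [NormedSpace ℝ V]
    (J : E ≃ₗᵢ[ℝ] StrongDual ℝ V) : Prop :=
  ∀ (W : Type w) [NormedAddCommGroup W] [NormedSpace ℝ W] [CompleteSpace W]
    (φ : E ≃ₗᵢ[ℝ] StrongDual ℝ W),
    Continuous fun x : WeakDual ℝ V =>
      StrongDual.toWeakDual (φ (J.symm (WeakDual.toStrongDual x)))

end

/-! Uniqueness: the norm of `Lip(X)` determines which functionals are weak* continuous. In the unit
ball, `a ≤ f p` is equivalent to `g ≤ f`, where `g` is the lower bound on `f` that it forces, and `g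
≤ f` says that `f` lies in one large ball centred at `g` plus a constant
(`Lip.le_apply_iff_norm_sub_le`). Isometries preserve balls, and closed balls of `W*` are weak*
closed, so a point evaluation cuts weak* closed half spaces out of the unit ball of `W*`. By
`exists_eq_inclusionInDoubleDual` it is therefore given by a vector of `W`. Point evaluations
separate points, so by Hahn-Banach the vectors common to `W` and `Æ(Y)` are dense in `W`; their two
norms agree, and completeness of `Æ(Y)` makes every vector of `W` common
(`exists_predual_vector_of_separating`).

Duality: a functional `x` on `Æ(Y)` amounts to the Lipschitz function `p ↦ x (δ_p)`. The metric of
`Y` turns both terms of the norm of `Lip(X)` into slopes: those towards `e` give the sup norm, and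
this controls the slopes altered by the truncation at 2. -/

open Metric Set

/-! ### Weak* continuous functionals on a dual Banach space -/

section dual

variable {W : Type*} [NormedAddCommGroup W] [NormedSpace ℝ W]

/-- A weak* closed set that misses the origin misses the annihilator of some finite set. -/
theorem exists_finset_annihilator_notMem {C : Set (WeakDual ℝ W)} (hC : IsClosed C)
    (h0 : (0 : WeakDual ℝ W) ∉ C) :
    ∃ s : Finset W, ∀ x : WeakDual ℝ W, (∀ w ∈ s, x w = 0) → x ∉ C := by
  have hU : Cᶜ ∈ nhds (0 : WeakDual ℝ W) := hC.isOpen_compl.mem_nhds h0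
  rw [(WeakDual.withSeminorms ℝ W).mem_nhds_iff] at hU
  obtain ⟨s, r, hr, hs⟩ := hU
  refine ⟨s, fun x hx => hs ?_⟩
  rw [Seminorm.mem_ball, sub_zero]
  refine Seminorm.finset_sup_apply_lt hr fun w hw => ?_
  rw [WeakDual.seminormFamily_apply, hx w hw, norm_zero]
  exact hr

/-- A functional on a dual space that is small on the unit ball of the annihilator of a finite
set is close to the evaluation at a vector. -/
theorem exists_norm_sub_inclusionInDoubleDual_le (Λ : StrongDual ℝ (StrongDual ℝ W)) {ε : ℝ}
    (hε : 0 ≤ ε) (s : Finset W)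
    (hs : ∀ x : StrongDual ℝ W, ‖x‖ ≤ 1 → (∀ w ∈ s, x w = 0) → |Λ x| ≤ ε) :
    ∃ w : W, ‖Λ - NormedSpace.inclusionInDoubleDual ℝ W w‖ ≤ ε := by
  let ev : s → StrongDual ℝ W →ₗ[ℝ] ℝ :=
    fun w => (NormedSpace.inclusionInDoubleDual ℝ W w : StrongDual ℝ W →ₗ[ℝ] ℝ)
  let N : Submodule ℝ (StrongDual ℝ W) := ⨅ w, LinearMap.ker (ev w)
  have hN : ∀ x ∈ N, ∀ w ∈ s, x w = 0 := fun x hx w hw =>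
    (Submodule.mem_iInf _).1 hx ⟨w, hw⟩
  -- Hahn-Banach extends the restriction of `Λ` to `N` without enlarging its norm. Then `Λ - g`
  -- vanishes on a finite intersection of kernels of evaluations, hence is a combination of them.
  obtain ⟨g, hg, hgn⟩ := exists_extension_norm_eq N (Λ.comp N.subtypeL)
  have hgε : ‖g‖ ≤ ε := by
    rw [hgn]
    refine ContinuousLinearMap.opNorm_le_of_unit_norm hε fun x hx => ?_
    exact hs x hx.le (hN x x.2)
  have hker : N ≤ LinearMap.ker ((Λ - g : StrongDual ℝ (StrongDual ℝ W)) :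
      StrongDual ℝ W →ₗ[ℝ] ℝ) := by
    intro x hx
    have h := hg ⟨x, hx⟩
    have h' : g x = Λ x := h
    simp [h']
  have hspan := mem_span_of_iInf_ker_le_ker hker
  obtain ⟨c, hc⟩ := (Submodule.mem_span_range_iff_exists_fun ℝ).1 hspan
  refine ⟨∑ w : s, c w • (w : W), ?_⟩
  have : Λ - NormedSpace.inclusionInDoubleDual ℝ W (∑ w : s, c w • (w : W)) = g := by
    ext x
    have := LinearMap.congr_fun hc x
    simp only [LinearMap.sum_apply, LinearMap.smul_apply, ev] at this
    simp only [map_sum, map_smul, sub_apply, sum_apply, smul_apply]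
    have h2 : ∑ w : s, c w • NormedSpace.inclusionInDoubleDual ℝ W w x = Λ x - g x := this
    rw [h2, sub_sub_cancel]
  rw [this]
  exact hgε

/-- A functional on the dual of a Banach space is an evaluation if the half spaces it defines
meet the unit ball in weak* closed sets. -/
theorem exists_eq_inclusionInDoubleDual [CompleteSpace W] (Λ : StrongDual ℝ (StrongDual ℝ W))
    (hΛ : ∀ ε > 0, IsClosed {x : WeakDual ℝ W |
      ‖WeakDual.toStrongDual x‖ ≤ 1 ∧ ε ≤ Λ (WeakDual.toStrongDual x)}) :
    ∃ w : W, ∀ x : StrongDual ℝ W, Λ x = x w := by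
  -- Completeness of `W` enters here: it now suffices to approximate `Λ` in norm by evaluations.
  have hcl : IsClosed (range (NormedSpace.inclusionInDoubleDualLi (E := W) ℝ)) :=
    (NormedSpace.inclusionInDoubleDualLi (E := W) ℝ).isometry.isUniformInducing.isComplete_range.isClosed
  have hmem : Λ ∈ range (NormedSpace.inclusionInDoubleDualLi (E := W) ℝ) := by
    refine hcl.closure_subset
      ((Metric.mem_closure_iff (α := StrongDual ℝ (StrongDual ℝ W))).2 fun ε hε => ?_)
    have hε2 : 0 < ε / 2 := half_pos hε
    obtain ⟨s, hs⟩ := exists_finset_annihilator_notMem (hΛ _ hε2) fun h => by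
      have h2 : ε / 2 ≤ Λ 0 := h.2
      rw [map_zero] at h2
      exact hε2.not_ge h2
    obtain ⟨w, hw⟩ := exists_norm_sub_inclusionInDoubleDual_le Λ hε2.le s fun x hx hxs => by
      -- The half space controls only one sign; the other follows by passing to `-x`, which lies in
      -- the same annihilator.
      refine abs_le.2 ⟨?_, ?_⟩
      · by_contra! h
        refine hs (StrongDual.toWeakDual (-x)) (fun w hw => ?_) ⟨?_, ?_⟩
        · change -(x w) = 0
          rw [hxs w hw, neg_zero]
        · change ‖-x‖ ≤ 1
          rwa [norm_neg]
        · change ε / 2 ≤ Λ (-x)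
          rw [map_neg]
          linarith
      · by_contra! h
        exact hs (StrongDual.toWeakDual x) hxs ⟨hx, h.le⟩
    exact ⟨_, ⟨w, rfl⟩, (dist_eq_norm Λ _).trans_lt (hw.trans_lt (half_lt_self hε))⟩
  obtain ⟨w, hw⟩ := hmem
  exact ⟨w, fun x => by rw [← hw]; rfl⟩

/-- Let `J` and `φ` be isometric isomorphisms of `E` onto `V*` and `W*`. If the vectors of `W`
that correspond to vectors of `V` separate the points of `E`, then all vectors of `W` do. -/
theorem exists_predual_vector_of_separating {E V : Type*} [NormedAddCommGroup E]
    [NormedSpace ℝ E] [NormedAddCommGroup V] [NormedSpace ℝ V] [CompleteSpace V]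
    (J : E ≃ₗᵢ[ℝ] StrongDual ℝ V) (φ : E ≃ₗᵢ[ℝ] StrongDual ℝ W)
    (hsep : ∀ f : E, (∀ (w : W) (v : V), (∀ g, φ g w = J g v) → φ f w = 0) → f = 0) (w : W) :
    ∃ v : V, ∀ f, φ f w = J f v := by
  -- Both norms are suprema over the same unit ball of `E`; only this inequality is needed.
  have hnorm : ∀ (w : W) (v : V), (∀ g, φ g w = J g v) → ‖v‖ ≤ ‖w‖ := fun w v h => by
    refine NormedSpace.norm_le_dual_bound ℝ v (norm_nonneg w) fun x => ?_
    have := h (J.symm x)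
    rw [LinearIsometryEquiv.apply_symm_apply] at this
    rw [← this, mul_comm]
    refine ((φ (J.symm x)).le_opNorm w).trans_eq ?_
    simp
  let N : Submodule ℝ W :=
    { carrier := {w | ∃ v : V, ∀ f, φ f w = J f v}
      zero_mem' := ⟨0, by simp⟩
      add_mem' := by
        rintro a b ⟨v, hv⟩ ⟨u, hu⟩
        exact ⟨v + u, fun f => by simp [hv, hu]⟩
      smul_mem' := by
        rintro c a ⟨v, hv⟩
        exact ⟨c • v, fun f => by simp [hv]⟩ }
  have hdense : w ∈ N.topologicalClosure := by
    by_contra hw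
    obtain ⟨x, u, hxu, hux⟩ := geometric_hahn_banach_closed_point
      N.topologicalClosure.convex N.isClosed_topologicalClosure hw
    have hu : 0 < u := by simpa using hxu 0 (zero_mem _)
    -- A functional bounded above on a subspace vanishes there: otherwise a multiple of `a` attains
    -- the value `u`.
    have hx : ∀ a ∈ N, x a = 0 := fun a ha => by
      by_contra hne
      have h1 := hxu ((u / x a) • a) (N.le_topologicalClosure (N.smul_mem _ ha))
      rw [map_smul, smul_eq_mul, div_mul_cancel₀ _ hne] at h1
      exact lt_irrefl _ h1
    have h0 : φ.symm x = 0 := hsep _ fun a v hav => by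
      rw [LinearIsometryEquiv.apply_symm_apply]
      exact hx a ⟨v, hav⟩
    have hx0 : x = 0 := by
      rw [← φ.apply_symm_apply x, h0, map_zero]
    rw [hx0] at hux
    exact hu.not_gt hux
  obtain ⟨a, haN, haw⟩ := mem_closure_iff_seq_limit.1 hdense
  choose v hv using haN
  have hcauchy : CauchySeq v := by
    refine Metric.cauchySeq_iff.2 fun ε hε => ?_
    obtain ⟨n, hn⟩ := Metric.cauchySeq_iff.1 haw.cauchySeq ε hε
    refine ⟨n, fun i hi j hj => lt_of_le_of_lt ?_ (hn i hi j hj)⟩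
    rw [dist_eq_norm, dist_eq_norm]
    exact hnorm _ _ fun g => by simp [hv]
  obtain ⟨v₀, hv₀⟩ := cauchySeq_tendsto_of_complete hcauchy
  refine ⟨v₀, fun f => ?_⟩
  refine tendsto_nhds_unique (((φ f).continuous.tendsto w).comp haw) ?_
  refine (((J f).continuous.tendsto v₀).comp hv₀).congr fun n => ?_
  exact (hv n f).symm

end dual

/-! ### Half spaces of point evaluations in the unit ball of `Lip(X)` -/

namespace Lip

variable {X : Type*} [MetricSpace X]

@[simp] theorem add_apply (f g : Lip X) (p : X) : (f + g) p = f p + g p := rfl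

@[simp] theorem sub_apply (f g : Lip X) (p : X) : (f - g) p = f p - g p := rfl

theorem ext {f g : Lip X} (h : ∀ p, f p = g p) : f = g := Subtype.ext (funext h)

theorem abs_apply_le (f : Lip X) (p : X) : |f p| ≤ ‖f‖ :=
  (abs_le_supNumber f.2.2 p).trans (le_max_right _ _)

theorem abs_sub_le (f : Lip X) (p q : X) : |f p - f q| ≤ ‖f‖ * dist p q :=
  (abs_sub_le_lipNumber f.2.1 p q).trans
    (mul_le_mul_of_nonneg_right (le_max_left _ _) dist_nonneg)

theorem norm_le {f : Lip X} {c : ℝ} (hc : 0 ≤ c) (h : ∀ p, |f p| ≤ c)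
    (h' : ∀ p q, |f p - f q| ≤ c * dist p q) : ‖f‖ ≤ c :=
  max_le (lipNumber_le hc h') (Real.iSup_le h hc)

/-- The order interval `g ≤ f` in the unit ball is cut out by a single ball. -/
theorem forall_le_iff_norm_sub_le (g : Lip X) :
    ∃ (h : Lip X) (r : ℝ), ∀ f : Lip X, ‖f‖ ≤ 1 → ((∀ p, g p ≤ f p) ↔ ‖f - h‖ ≤ r) := by
  have hR : 0 ≤ 1 + ‖g‖ := by positivity
  -- Adding this constant makes the upper bound on `f - (g + c)` automatic and leaves the slopes
  -- unchanged, so the ball records only `g ≤ f`.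
  let c : Lip X := ⟨fun _ => 1 + ‖g‖, ⟨0, LipschitzWith.const _⟩, _, fun _ => le_rfl⟩
  have hc : ∀ p, c p = 1 + ‖g‖ := fun _ => rfl
  refine ⟨g + c, 1 + ‖g‖, fun f hf => ⟨fun hgf => norm_le hR (fun p => ?_) fun p q => ?_,
    fun h p => ?_⟩⟩
  · have h1 := abs_le.1 ((abs_apply_le f p).trans hf)
    have h2 := abs_le.1 (abs_apply_le g p)
    have h3 := hgf p
    rw [sub_apply, add_apply, hc, abs_le]
    constructor <;> linarith
  · have h1 := abs_sub_le (f - g) p q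
    have h2 : ‖f - g‖ ≤ 1 + ‖g‖ := (norm_sub_le f g).trans (by linarith)
    have h3 : (f - (g + c)) p - (f - (g + c)) q = (f - g) p - (f - g) q := by
      simp only [sub_apply, add_apply, hc]; ring
    rw [h3]
    exact h1.trans (mul_le_mul_of_nonneg_right h2 dist_nonneg)
  · have h1 := (abs_le.1 ((abs_apply_le _ p).trans h)).1
    rw [sub_apply, add_apply, hc] at h1
    linarith

/-- In the unit ball of `Lip(X)`, the half space `a ≤ f p` is cut out by a single ball. -/
theorem le_apply_iff_norm_sub_le (p : X) (a : ℝ) :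
    ∃ (h : Lip X) (r : ℝ), ∀ f : Lip X, ‖f‖ ≤ 1 → (a ≤ f p ↔ ‖f - h‖ ≤ r) := by
  -- The first term is forced by `L(f) ≤ 1`, the second by `‖f‖_∞ ≤ 1`; the cutoff also keeps `g`
  -- bounded.
  let g : Lip X := ⟨fun x => max (a - dist x p) (-1), ⟨_,
    (((LipschitzWith.const a).sub (LipschitzWith.dist_left p)).max_const (-1))⟩, max |a| 1,
    fun x => by
      have hd := dist_nonneg (x := x) (y := p)
      have h1 := le_abs_self a
      rw [abs_le]
      constructor
      · exact (neg_le_neg (le_max_right _ _)).trans (le_max_right _ _)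
      · exact max_le ((by linarith : a - dist x p ≤ |a|).trans (le_max_left _ _))
          ((by norm_num : (-1 : ℝ) ≤ 1).trans (le_max_right _ _))⟩
  have hg : ∀ x, g x = max (a - dist x p) (-1) := fun _ => rfl
  obtain ⟨h, r, hr⟩ := forall_le_iff_norm_sub_le g
  refine ⟨h, r, fun f hf => Iff.trans ⟨fun ha x => ?_, fun hgf => ?_⟩ (hr f hf)⟩
  · rw [hg]
    refine max_le ?_ (abs_le.1 ((abs_apply_le f x).trans hf)).1
    have h1 := (abs_le.1 (abs_sub_le f x p)).1
    have h2 : ‖f‖ * dist x p ≤ dist x p := mul_le_of_le_one_left dist_nonneg hf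
    linarith
  · have h1 := hgf p
    rw [hg, dist_self, sub_zero] at h1
    exact (le_max_left _ _).trans h1

/-- The point evaluation at `p` on `Lip(X)`. -/
noncomputable def evalCLM (p : X) : StrongDual ℝ (Lip X) :=
  LinearMap.mkContinuous
    { toFun := fun f => f p
      map_add' := fun _ _ => rfl
      map_smul' := fun _ _ => rfl }
    1 fun f => (abs_apply_le f p).trans_eq (one_mul _).symm

@[simp] theorem evalCLM_apply (p : X) (f : Lip X) : evalCLM p f = f p := rfl

/-- Under every isometric isomorphism of `Lip(X)` onto the dual of a Banach space `W`, the point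
evaluations are given by vectors of `W`. -/
theorem exists_predual_vector_eval {W : Type*} [NormedAddCommGroup W] [NormedSpace ℝ W]
    [CompleteSpace W] (φ : Lip X ≃ₗᵢ[ℝ] StrongDual ℝ W) (p : X) :
    ∃ w : W, ∀ f : Lip X, φ f w = f p := by
  obtain ⟨w, hw⟩ := exists_eq_inclusionInDoubleDual
    ((evalCLM p).comp (φ.symm.toContinuousLinearEquiv : StrongDual ℝ W →L[ℝ] Lip X))
    fun ε _ => by
      obtain ⟨h, r, hr⟩ := le_apply_iff_norm_sub_le p ε
      convert (WeakDual.isClosed_closedBall (0 : StrongDual ℝ W) 1).inter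
        (WeakDual.isClosed_closedBall (φ h) r) using 1
      ext x
      have h1 : ‖WeakDual.toStrongDual x - φ h‖ = ‖φ.symm (WeakDual.toStrongDual x) - h‖ := by
        rw [← φ.norm_map (_ - h), map_sub, LinearIsometryEquiv.apply_symm_apply]
      simp only [mem_ofPred_eq, mem_inter_iff, mem_preimage, mem_closedBall, dist_eq_norm,
        sub_zero, h1]
      exact and_congr_right fun hx => hr (φ.symm (WeakDual.toStrongDual x)) (by rwa [LinearIsometryEquiv.norm_map])
  refine ⟨w, fun f => ?_⟩
  rw [← hw]
  simp

end Lip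

/-! ### `Lip(X)` as the dual of the Arens-Eells space -/

namespace ArensEells

section general

variable {Y : Type*} [MetricSpace Y] {e : Y}

/-- The pairing of `Lip₀(Y)` with `Æ(Y)`. -/
noncomputable def pairing (Y : Type*) [MetricSpace Y] (e : Y) :
    LipZero Y e →L[ℝ] StrongDual ℝ (ArensEells Y e) :=
  (ContinuousLinearMap.compL ℝ (ArensEells Y e) (StrongDual ℝ (LipZero Y e)) ℝ).flip
    (arensEellsSubmodule Y e).subtypeL ∘L NormedSpace.inclusionInDoubleDual ℝ (LipZero Y e)

theorem pairing_delta (f : LipZero Y e) (p : Y) : pairing Y e f (delta e p) = f p := rfl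

theorem norm_delta_sub_le (p q : Y) : ‖delta e p - delta e q‖ ≤ dist p q := by
  refine ContinuousLinearMap.opNorm_le_bound _ dist_nonneg fun f => ?_
  rw [mul_comm]
  exact abs_sub_le_lipNumber f.2.1 p q

/-- Elements of `Æ(Y)` carry their operator norm, which gives `≤`; testing on the differences `δ_p -
δ_q` recovers each slope. -/
theorem norm_pairing (f : LipZero Y e) : ‖pairing Y e f‖ = ‖f‖ := by
  refine le_antisymm ?_ ?_
  · refine ContinuousLinearMap.opNorm_le_bound _ (norm_nonneg _) fun m => ?_
    rw [mul_comm]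
    exact m.1.le_opNorm f
  · refine lipNumber_le (norm_nonneg _) fun p q => ?_
    have h := (pairing Y e f).le_of_opNorm_le_of_le le_rfl (norm_delta_sub_le (e := e) p q)
    rwa [map_sub, pairing_delta, pairing_delta] at h

theorem delta_base : delta e e = 0 := by
  refine Subtype.ext (ContinuousLinearMap.ext fun f => ?_)
  exact f.2.2

/-- Functionals on `Æ(Y)` that agree on the point evaluations are equal. -/
theorem dual_ext {x y : StrongDual ℝ (ArensEells Y e)}
    (h : ∀ p, x (delta e p) = y (delta e p)) : x = y := by
  -- Extending to all of `Lip₀(Y)*` lets the closed kernel be compared with the closed span in the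
  -- ambient space.
  obtain ⟨z, hz, -⟩ := exists_extension_norm_eq (arensEellsSubmodule Y e) (x - y)
  have hle : arensEellsSubmodule Y e ≤ LinearMap.ker (z : _ →ₗ[ℝ] ℝ) := by
    refine Submodule.topologicalClosure_minimal _ (Submodule.span_le.2 ?_) z.isClosed_ker
    rintro _ ⟨p, rfl⟩
    have hp : z (LipZero.eval e p) = x (delta e p) - y (delta e p) := hz (delta e p)
    exact hp.trans (sub_eq_zero.2 (h p))
  refine ContinuousLinearMap.ext fun m => sub_eq_zero.1 ?_
  exact (hz m).symm.trans (hle m.2)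

theorem pairing_surjective : Function.Surjective (pairing Y e) := by
  intro x
  refine ⟨⟨fun p => x (delta e p), ⟨‖x‖₊, LipschitzWith.of_dist_le_mul fun p q => ?_⟩, ?_⟩, ?_⟩
  · rw [Real.dist_eq, ← map_sub]
    exact x.le_of_opNorm_le_of_le le_rfl (norm_delta_sub_le p q)
  · change x (delta e e) = 0
    rw [delta_base, map_zero]
  · exact dual_ext fun p => rfl

/-- The isometric isomorphism of `Lip₀(Y)` onto the dual of `Æ(Y)`. -/
noncomputable def pairingEquiv (Y : Type*) [MetricSpace Y] (e : Y) :
    LipZero Y e ≃ₗᵢ[ℝ] StrongDual ℝ (ArensEells Y e) :=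
  LinearIsometryEquiv.ofSurjective ⟨(pairing Y e).toLinearMap, norm_pairing⟩ pairing_surjective

end general

end ArensEells

/-! ### Extension by zero to `X ∪ {e}`, and the conclusion -/

namespace Lip

variable {X : Type*} [MetricSpace X]

/-- Extension by `0` at the base point. -/
def extend (f : X → ℝ) : WithBase X → ℝ
  | none => 0
  | some p => f p

/-- Distance 1 to `e` matches the sup norm, and the truncation at 2 costs nothing because `|f p - f
q| ≤ 2‖f‖`. -/
theorem abs_extend_sub_le (f : Lip X) (p q : WithBase X) :
    |extend f p - extend f q| ≤ ‖f‖ * dist p q := by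
  rcases p with _ | p <;> rcases q with _ | q
  · change |(0 : ℝ) - 0| ≤ ‖f‖ * 0
    simp
  · change |0 - f q| ≤ ‖f‖ * 1
    simpa using abs_apply_le f q
  · change |f p - 0| ≤ ‖f‖ * 1
    simpa using abs_apply_le f p
  · change |f p - f q| ≤ ‖f‖ * min (dist p q) 2
    rw [mul_min_of_nonneg _ _ (norm_nonneg f)]
    refine le_min (abs_sub_le f p q) ((_root_.abs_sub _ _).trans ?_)
    linarith [abs_apply_le f p, abs_apply_le f q]

/-- Extension by `0` at the base point, as a linear isometry of `Lip(X)` into `Lip₀(X ∪ {e})`. -/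
noncomputable def extendLi (X : Type*) [MetricSpace X] :
    Lip X →ₗᵢ[ℝ] LipZero (WithBase X) WithBase.base where
  toFun f := ⟨extend f, ⟨‖f‖₊, LipschitzWith.of_dist_le_mul fun p q => abs_extend_sub_le f p q⟩,
    rfl⟩
  map_add' f g := Subtype.ext <| funext fun p => by
    rcases p with _ | p
    · exact (add_zero (0 : ℝ)).symm
    · rfl
  map_smul' c f := Subtype.ext <| funext fun p => by
    rcases p with _ | p
    · exact (mul_zero c).symm
    · rfl
  norm_map' f := by
    set F : LipZero (WithBase X) WithBase.base := ⟨extend f, ⟨‖f‖₊,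
      LipschitzWith.of_dist_le_mul fun p q => abs_extend_sub_le f p q⟩, rfl⟩
    refine le_antisymm (lipNumber_le (norm_nonneg f) (abs_extend_sub_le f)) ?_
    refine norm_le (norm_nonneg F) (fun p => ?_) fun p q => ?_
    · have h := LipZero.abs_apply_le F (WithBase.of p)
      have h' : |f p| ≤ 1 * ‖F‖ := h
      rwa [one_mul] at h'
    · have h : |f p - f q| ≤ ‖F‖ * min (dist p q) 2 :=
        abs_sub_le_lipNumber F.2.1 (WithBase.of p) (WithBase.of q)
      exact h.trans (mul_le_mul_of_nonneg_left (min_le_left _ _) (norm_nonneg F))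

theorem extendLi_surjective : Function.Surjective (extendLi X) := by
  intro F
  have hF := abs_sub_le_lipNumber F.2.1
  refine ⟨⟨fun p => F (WithBase.of p), ⟨‖F‖₊, LipschitzWith.of_dist_le_mul fun p q => ?_⟩, ‖F‖,
    fun p => ?_⟩, Subtype.ext <| funext fun p => ?_⟩
  · have h : |F (WithBase.of p) - F (WithBase.of q)| ≤ ‖F‖ * min (dist p q) 2 := hF _ _
    exact h.trans (mul_le_mul_of_nonneg_left (min_le_left _ _) (norm_nonneg F))
  · have h : |F (WithBase.of p)| ≤ 1 * ‖F‖ := LipZero.abs_apply_le F _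
    rwa [one_mul] at h
  · rcases p with _ | p
    · exact F.2.2.symm
    · rfl

/-- The isometric isomorphism of `Lip(X)` onto the dual of `Æ(X ∪ {e})`. -/
noncomputable def arensEellsEquiv (X : Type*) [MetricSpace X] :
    Lip X ≃ₗᵢ[ℝ] StrongDual ℝ (ArensEells (WithBase X) WithBase.base) :=
  (LinearIsometryEquiv.ofSurjective (extendLi X) extendLi_surjective).trans
    (ArensEells.pairingEquiv (WithBase X) WithBase.base)

theorem arensEellsEquiv_delta (f : Lip X) (p : X) :
    arensEellsEquiv X f (ArensEells.delta WithBase.base (WithBase.of p)) = f p := rfl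

theorem isStronglyUniquePredual_arensEellsEquiv (X : Type u) [MetricSpace X] :
    IsStronglyUniquePredual.{u, u, w} (arensEellsEquiv X) := by
  intro W _ _ _ φ
  -- Weak* continuity is tested on each `w`, whose coordinate will be evaluation at a vector of
  -- `Æ(Y)`.
  refine WeakBilin.continuous_of_continuous_eval _ fun w => ?_
  have hsep : ∀ f : Lip X, (∀ (a : W) v, (∀ g, φ g a = arensEellsEquiv X g v) → φ f a = 0) →
      f = 0 := fun f hf => Lip.ext fun p => by
    obtain ⟨a, ha⟩ := exists_predual_vector_eval φ p
    rw [← ha f]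
    exact hf a (ArensEells.delta WithBase.base (WithBase.of p)) fun g => ha g
  obtain ⟨v, hv⟩ := exists_predual_vector_of_separating (arensEellsEquiv X) φ hsep w
  refine (WeakBilin.eval_continuous (topDualPairing ℝ _) v).congr fun x => ?_
  have h := hv ((arensEellsEquiv X).symm (WeakDual.toStrongDual x))
  rw [LinearIsometryEquiv.apply_symm_apply] at h
  exact h.symm

end Lip

/-- `Æ(Y)` is the strongly unique Banach space predual of `Lip(X)`, where `Y = X ∪ {e}`: the
pairing determined by `⟨δ_p, f⟩ = f(p)` identifies `Lip(X)` with `Æ(Y)*` isometrically, and every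
isometric isomorphism of `Lip(X)` onto a dual Banach space is weak* continuous. -/
theorem theorem2p4 (X : Type u) [MetricSpace X] :
    ∃ J : Lip X ≃ₗᵢ[ℝ] StrongDual ℝ (ArensEells (WithBase X) WithBase.base),
      (∀ (f : Lip X) (p : X),
        J f (ArensEells.delta WithBase.base (WithBase.of p)) = f p) ∧
      IsStronglyUniquePredual.{u, u, w} J :=
  ⟨Lip.arensEellsEquiv X, Lip.arensEellsEquiv_delta, Lip.isStronglyUniquePredual_arensEellsEquiv X⟩
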